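/- Let $(\Omega,\mathcal F,\mathbb P)$ be a probability space. Let $(C_n)_{n\ge 1}$ be the points, listed in increasing order, of a Poisson point process on $\mathbb R_+$ with intensity the Lebesgue measure. Let $S=(B_n,X_n)_{n\ge1}$ be a Poisson point process on $(0,\infty)\times[0,1]$ with intensity the Lebesgue measure, independent of $(C_n)_{n\ge1}$, its points being listed so that $(B_n)_{n\ge1}$ is increasing. Let $\psi:\mathbb R\to\mathbb R$ be a Lipschitz function that vanishes outside $[-1,1]$, and let $\eta\in(0,1)$ and $\alpha<0$ satisfy $\eta-1<\alpha\eta$. Consider the sum of random pulses $$F_{\alpha,\eta}(x)=\sum_{n=1}^{\infty} C_n^{-\alpha}\,\psi\bigl(B_n^{1/\eta}(x-X_n)\bigr),\qquad x\in\mathbb R .$$ Then, almost surely, this series converges (absolutely) for Lebesgue-almost every $x\in\mathbb R$, and for all $p\in\bigl(1,\,-\tfrac1{\alpha\eta}+\tfrac1\alpha\bigr)$ its sum $F_{\alpha,\eta}$ belongs to $L^p_{\mathrm{loc}}([0,1])$, that is, to $L^p(K)$ for every compact $K\subseteq[0,1]$. -/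

import Mathlib

open MeasureTheory ProbabilityTheory Set
open scoped ENNReal NNReal

namespace RandomPulses

/-- The counting measure `∑ₙ δ_{Y n}` of a sequence of points `Y` of `E`: the value on a
measurable set `A` is the number (possibly `∞`) of indices `n` with `Y n ∈ A`. -/
noncomputable def countingMeasure {E : Type*} [MeasurableSpace E] (Y : ℕ → E) : Measure E :=
  Measure.sum fun n => Measure.dirac (Y n)

/-- The random sequence `Y 0, Y 1, …` enumerates (every point once, counted with multiplicity) a
Poisson point process on `E` with intensity measure `μ`: the number of points in a measurable set
`A` of finite `μ`-measure has the Poisson law of parameter `μ A`, and the numbers of points in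
finitely many pairwise disjoint measurable sets are independent. As the points are enumerated by
`ℕ`, there are infinitely many of them, which is the case for infinite (σ-finite) intensities. -/
structure IsPoissonPointProcess {Ω E : Type*} [MeasurableSpace Ω] [MeasurableSpace E]
    (P : Measure Ω) (Y : ℕ → Ω → E) (μ : Measure E) : Prop where
  measurable : ∀ n, Measurable (Y n)
  poisson_law : ∀ A : Set E, MeasurableSet A → μ A ≠ ∞ →
    P.map (fun ω => countingMeasure (fun n => Y n ω) A) =
      (poissonMeasure (μ A).toNNReal).map (fun k : ℕ => (k : ℝ≥0∞))
  indep : ∀ (m : ℕ) (A : Fin m → Set E), (∀ i, MeasurableSet (A i)) →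
    Pairwise (fun i j => Disjoint (A i) (A j)) →
    iIndepFun (fun i ω => countingMeasure (fun n => Y n ω) (A i)) P

/-- The `n`-th term `Cₙ^(-α) ψ(Bₙ^(1/η) (x - Xₙ))` of the sum of pulses. -/
noncomputable def pulse (ψ : ℝ → ℝ) (α η : ℝ) (C B X : ℕ → ℝ) (n : ℕ) (x : ℝ) : ℝ :=
  C n ^ (-α) * ψ (B n ^ (1 / η) * (x - X n))

/-- The sum of pulses `F_{α,η}(x) = ∑ₙ Cₙ^(-α) ψ(Bₙ^(1/η) (x - Xₙ))`; the sequences are indexed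
from `0` instead of `1`. -/
noncomputable def pulseSum (ψ : ℝ → ℝ) (α η : ℝ) (C B X : ℕ → ℝ) (x : ℝ) : ℝ :=
  ∑' n, pulse ψ α η C B X n x

/-- `f ∈ L^p_loc(s)`: the function `f` is in `L^p(K)`, for the Lebesgue measure, for every compact
`K ⊆ s`. -/
def MemLpLocOn (f : ℝ → ℝ) (p : ℝ≥0∞) (s : Set ℝ) : Prop :=
  ∀ K : Set ℝ, IsCompact K → K ⊆ s → MemLp f p (volume.restrict K)

end RandomPulses

namespace RandomPulses

/-! ### Counts, exponential bounds and moments of Poisson processes. -/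

section PointProcess

variable {Ω E : Type*} [MeasurableSpace Ω] [MeasurableSpace E] {P : Measure Ω}
  {Y : ℕ → Ω → E} {μ : Measure E}

/-! Ordered Poisson points grow linearly, so almost surely `C n ≤ K * B n` with a random `K`, and
the amplitude of a pulse is controlled by its own height: `C n ^ (-α) ≤ (K * B n) ^ (-α)`. A pulse
with `B n` of order `2 ^ j` reaches `x` only if `|x - X n| ≤ t ^ j`, up to a shift of `j`, where `t
= 2 ^ (-1/η)`. Hence the sum of absolute values is at most a constant times `∑ j, 2 ^ (-α j) * N j
x`, with `N j x` the number of points in a box of area at most `4 * (2t) ^ j`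
(`tsum_enorm_pulse_le`).

These areas are bounded, so the `p`-th moment of `N j x` is `O((2t) ^ j)`
(`exists_lintegral_count_rpow_le`). By Tonelli the `L^p` norm on `[0,1]` is almost surely finite
once `2 ^ (-α p) * 2t < 1` (`ae_lintegral_tsum_rpow_lt_top`), which is the upper bound on `p`.
Convergence almost everywhere is Borel–Cantelli in `x`: the supports have summable lengths, since
`1/η > 1`. -/

lemma countingMeasure_apply (y : ℕ → E) {A : Set E} (hA : MeasurableSet A) :
    countingMeasure y A = ∑' n, A.indicator 1 (y n) := by
  simp [countingMeasure, Measure.sum_apply _ hA, Measure.dirac_apply' _ hA]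

lemma countingMeasure_le_of_forall_notMem (y : ℕ → E) {A : Set E} (hA : MeasurableSet A) (m : ℕ)
    (h : ∀ n, m ≤ n → y n ∉ A) : countingMeasure y A ≤ m := by
  rw [countingMeasure_apply y hA, tsum_eq_sum (s := Finset.range m)]
  · refine (Finset.sum_le_card_nsmul _ _ 1 fun n _ => ?_).trans (by simp)
    exact indicator_le_self' (by simp) (y n)
  · intro n hn
    exact indicator_of_notMem (h n (by simpa using hn)) _

lemma le_countingMeasure_of_forall_mem (y : ℕ → E) {A : Set E} (hA : MeasurableSet A) (m : ℕ)
    (h : ∀ n, n < m → y n ∈ A) : (m : ℝ≥0∞) ≤ countingMeasure y A := by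
  rw [countingMeasure_apply y hA]
  refine le_trans (le_of_eq ?_) (ENNReal.sum_le_tsum (Finset.range m))
  rw [Finset.sum_congr rfl fun n hn => indicator_of_mem (h n (Finset.mem_range.1 hn)) 1]
  simp

lemma notMem_of_countingMeasure_eq_zero {y : ℕ → E} {A : Set E} (hA : MeasurableSet A)
    (h : countingMeasure y A = 0) (n : ℕ) : y n ∉ A := by
  intro hn
  rw [countingMeasure_apply y hA, ENNReal.tsum_eq_zero] at h
  simpa [hn] using h n

lemma IsPoissonPointProcess.measurable_count (h : IsPoissonPointProcess P Y μ) {A : Set E}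
    (hA : MeasurableSet A) : Measurable fun ω => countingMeasure (fun n => Y n ω) A := by
  simp_rw [countingMeasure_apply _ hA]
  exact Measurable.tsum fun n => (measurable_one.indicator hA).comp (h.measurable n)

lemma lintegral_poissonMeasure (r : ℝ≥0) (f : ℕ → ℝ≥0∞) :
    ∫⁻ k, f k ∂(poissonMeasure r) =
      ∑' k, ENNReal.ofReal (Real.exp (-r) * r ^ k / (k.factorial : ℝ)) * f k := by
  simp [poissonMeasure, lintegral_sum_measure]

lemma IsPoissonPointProcess.lintegral_count (h : IsPoissonPointProcess P Y μ) {A : Set E}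
    (hA : MeasurableSet A) (hμ : μ A ≠ ∞) {f : ℝ≥0∞ → ℝ≥0∞} (hf : Measurable f) :
    ∫⁻ ω, f (countingMeasure (fun n => Y n ω) A) ∂P =
      ∑' k : ℕ, ENNReal.ofReal
        (Real.exp (-(μ A).toReal) * (μ A).toReal ^ k / (k.factorial : ℝ)) * f k := by
  rw [← lintegral_map hf (h.measurable_count hA), h.poisson_law A hA hμ,
    lintegral_map hf .of_discrete, lintegral_poissonMeasure]
  rfl

/-- Exponential Markov inequality: the indicator of `S` is at most `c * z ^ k` on integers, and a
Poisson variable `N` of mean `r` has `E[z ^ N] = exp (r (z - 1))`. Taking `z < 1` or `z > 1` gives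
the lower or the upper tail. -/
lemma IsPoissonPointProcess.chernoff (h : IsPoissonPointProcess P Y μ) {A : Set E}
    (hA : MeasurableSet A) (hμ : μ A ≠ ∞) {S : Set ℝ≥0∞} (hS : MeasurableSet S) {c z : ℝ}
    (hc : 0 ≤ c) (hz : 0 ≤ z) (hcz : ∀ k : ℕ, (k : ℝ≥0∞) ∈ S → 1 ≤ c * z ^ k) :
    P {ω | countingMeasure (fun n => Y n ω) A ∈ S} ≤
      ENNReal.ofReal (c * Real.exp ((μ A).toReal * (z - 1))) := by
  have h1 := h.lintegral_count hA hμ (measurable_one.indicator hS)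
  have h2 : P {ω | countingMeasure (fun n => Y n ω) A ∈ S} =
      ∫⁻ ω, S.indicator 1 (countingMeasure (fun n => Y n ω) A) ∂P := by
    exact (lintegral_indicator_one (h.measurable_count hA hS)).symm
  rw [h2, h1]
  set r := (μ A).toReal
  have hr : 0 ≤ r := ENNReal.toReal_nonneg
  have hs : HasSum (fun k : ℕ => c * (Real.exp (-r) * ((r * z) ^ k / (k.factorial : ℝ))))
      (c * Real.exp (r * (z - 1))) := by
    have := ((NormedSpace.expSeries_div_hasSum_exp (r * z)).mul_left (Real.exp (-r))).mul_left c
    rw [← Real.exp_eq_exp_ℝ, ← Real.exp_add] at this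
    rwa [show r * (z - 1) = -r + r * z by ring]
  rw [← hs.tsum_eq, ENNReal.ofReal_tsum_of_nonneg (fun k => by positivity) hs.summable]
  refine ENNReal.tsum_le_tsum fun k => ?_
  by_cases hk : (k : ℝ≥0∞) ∈ S
  · rw [indicator_of_mem hk, Pi.one_apply, mul_one]
    refine ENNReal.ofReal_le_ofReal ?_
    have : c * (Real.exp (-r) * ((r * z) ^ k / (k.factorial : ℝ))) =
      (Real.exp (-r) * r ^ k / (k.factorial : ℝ)) * (c * z ^ k) := by
      rw [mul_pow]; ring
    rw [this]
    exact le_mul_of_one_le_right (by positivity) (hcz k hk)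
  · simp [hk]

lemma IsPoissonPointProcess.ae_notMem (h : IsPoissonPointProcess P Y μ) {A : Set E}
    (hA : MeasurableSet A) (hμ : μ A = 0) : ∀ᵐ ω ∂P, ∀ n, Y n ω ∉ A := by
  have h1 := h.lintegral_count hA (by simp [hμ]) measurable_id
  have h2 : ∫⁻ ω, countingMeasure (fun n => Y n ω) A ∂P = 0 := by
    refine h1.trans (ENNReal.tsum_eq_zero.2 fun k => ?_)
    rcases k with _ | k <;> simp [hμ]
  rw [lintegral_eq_zero_iff (h.measurable_count hA)] at h2
  filter_upwards [h2] with ω hω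
  exact notMem_of_countingMeasure_eq_zero hA hω

/-- Poisson moments of order `p` are linear in the intensity, as long as the latter is bounded. -/
lemma IsPoissonPointProcess.exists_lintegral_count_rpow_le (h : IsPoissonPointProcess P Y μ)
    {p : ℝ} (hp : 0 < p) (R : ℝ≥0) : ∃ D : ℝ≥0∞, D ≠ ∞ ∧ ∀ A : Set E, MeasurableSet A → μ A ≤ R →
      ∫⁻ ω, countingMeasure (fun n => Y n ω) A ^ p ∂P ≤ D * μ A := by
  obtain ⟨m, hm⟩ := exists_nat_ge p
  set g : ℕ → ℝ := fun k =>
    (m.factorial : ℝ) * Real.exp 1 * ((Real.exp 1 * R) ^ k / (k.factorial : ℝ))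
  have hg : Summable g := (Real.summable_pow_div_factorial _).mul_left _
  have hg0 : ∀ k, 0 ≤ g k := fun k => by positivity
  refine ⟨ENNReal.ofReal (∑' k, g k), ENNReal.ofReal_ne_top, fun A hA hAR => ?_⟩
  have hμ : μ A ≠ ∞ := (hAR.trans_lt ENNReal.coe_lt_top).ne
  refine (h.lintegral_count hA hμ (f := fun x => x ^ p) (measurable_id.pow_const p)).trans_le ?_
  -- The term `k = 0` vanishes because `0 ^ p = 0`; every other term contains a factor `r`, whence
  -- the linear bound.
  rw [tsum_eq_zero_add' ENNReal.summable,
    ENNReal.ofReal_tsum_of_nonneg hg0 hg, ← ENNReal.tsum_mul_right]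
  simp only [Nat.cast_zero, ENNReal.zero_rpow_of_pos hp, mul_zero, zero_add]
  refine ENNReal.tsum_le_tsum fun k => ?_
  set r := (μ A).toReal with hr
  have hr0 : 0 ≤ r := ENNReal.toReal_nonneg
  have hrR : r ≤ R := ENNReal.toReal_mono ENNReal.coe_ne_top hAR
  have hk1 : (1 : ℝ) ≤ ((k + 1 : ℕ) : ℝ) := by simp
  have hpow : (((k + 1 : ℕ) : ℝ≥0∞)) ^ p = ENNReal.ofReal (((k + 1 : ℕ) : ℝ) ^ p) := by
    rw [← ENNReal.ofReal_rpow_of_pos (by positivity), ENNReal.ofReal_natCast]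
  have hμr : μ A = ENNReal.ofReal r := (ENNReal.ofReal_toReal hμ).symm
  rw [hpow, hμr, ← ENNReal.ofReal_mul (by positivity), ← ENNReal.ofReal_mul (hg0 k)]
  refine ENNReal.ofReal_le_ofReal ?_
  have e1 : ((k + 1 : ℕ) : ℝ) ^ p ≤ m.factorial * (Real.exp 1 * Real.exp 1 ^ k) := by
    calc ((k + 1 : ℕ) : ℝ) ^ p ≤ ((k + 1 : ℕ) : ℝ) ^ (m : ℝ) :=
          Real.rpow_le_rpow_of_exponent_le hk1 hm
      _ = ((k + 1 : ℕ) : ℝ) ^ m := Real.rpow_natCast _ _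
      _ ≤ m.factorial * Real.exp ((k + 1 : ℕ) : ℝ) := by
          have := Real.pow_div_factorial_le_exp (x := ((k + 1 : ℕ) : ℝ)) (by positivity) m
          rwa [div_le_iff₀' (by positivity)] at this
      _ = m.factorial * (Real.exp 1 * Real.exp 1 ^ k) := by
          rw [← pow_succ', ← Real.exp_nat_mul, mul_one]
  have e2 : Real.exp (-r) * r ^ (k + 1) / ((k + 1).factorial : ℝ) ≤
      R ^ k * r / (k.factorial : ℝ) := by
    have : Real.exp (-r) ≤ 1 := Real.exp_le_one_iff.2 (by linarith)
    have hf : (k.factorial : ℝ) ≤ ((k + 1).factorial : ℝ) := by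
      exact_mod_cast Nat.factorial_le (Nat.le_succ k)
    rw [pow_succ]
    have h3 : r ^ k ≤ (R : ℝ) ^ k := pow_le_pow_left₀ hr0 hrR k
    calc _ ≤ 1 * ((R : ℝ) ^ k * r) / ((k + 1).factorial : ℝ) := by gcongr
      _ ≤ _ := by rw [one_mul]; gcongr
  calc _ ≤ (R ^ k * r / (k.factorial : ℝ)) * (m.factorial * (Real.exp 1 * Real.exp 1 ^ k)) := by
        gcongr
    _ = g k * r := by simp only [g, mul_pow]; ring

end PointProcess

/-! ### Linear growth of the ordered points. -/

/-- The ordered points of a Poisson process of unit intensity on the line grow at most linearly. -/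
lemma IsPoissonPointProcess.ae_eventually_le {Ω : Type*} [MeasurableSpace Ω] {P : Measure Ω}
    {C : ℕ → Ω → ℝ} (hC : IsPoissonPointProcess P C (volume.restrict (Ici (0 : ℝ))))
    (hCmono : ∀ᵐ ω ∂P, Monotone fun n => C n ω) :
    ∀ᵐ ω ∂P, ∀ᶠ n : ℕ in Filter.atTop, C n ω ≤ 4 * n := by
  have hvol (n : ℕ) : volume.restrict (Ici (0 : ℝ)) (Iic (4 * n : ℝ)) =
      ENNReal.ofReal (4 * n) := by
    rw [Measure.restrict_apply measurableSet_Iic, Iic_inter_Ici, Real.volume_Icc, sub_zero]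
  -- Ratio of the Chernoff bounds for at most `n` points when the mean is `4n`, with `z = 1/2`.
  have hlt : 2 * Real.exp (-2) < 1 := by
    have := Real.add_one_lt_exp (x := 2) (by norm_num)
    rw [Real.exp_neg, ← div_eq_mul_inv, div_lt_one (Real.exp_pos _)]
    linarith
  have hbc := ae_eventually_notMem (μ := P)
    (s := fun n => {ω | countingMeasure (fun i => C i ω) (Iic (4 * n : ℝ)) ∈ Iic (n : ℝ≥0∞)}) ?_
  · filter_upwards [hbc, hCmono] with ω hω hmono
    filter_upwards [hω] with n hn
    by_contra! hlt
    exact hn (countingMeasure_le_of_forall_notMem _ measurableSet_Iic n fun i hi =>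
      notMem_Iic.2 (hlt.trans_le (hmono hi)))
  · refine ne_top_of_le_ne_top ?_ (ENNReal.tsum_le_tsum fun n => hC.chernoff measurableSet_Iic
      (by rw [hvol]; exact ENNReal.ofReal_ne_top) measurableSet_Iic (c := 2 ^ n) (z := 1 / 2) (by positivity) (by norm_num) ?_)
    · have : ∀ n : ℕ, (2 : ℝ) ^ n * Real.exp ((volume.restrict (Ici (0 : ℝ))
          (Iic (4 * n : ℝ))).toReal * (1 / 2 - 1)) = (2 * Real.exp (-2)) ^ n := by
        intro n
        rw [hvol, ENNReal.toReal_ofReal (by positivity), mul_pow, ← Real.exp_nat_mul]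
        ring_nf
      simp_rw [this]
      exact (summable_geometric_of_lt_one (by positivity) hlt).tsum_ofReal_ne_top
    · intro k hk
      have hk' : k ≤ n := by simpa using hk
      rw [one_div, inv_pow, ← div_eq_mul_inv, one_le_div (by positivity)]
      exact pow_le_pow_right₀ (by norm_num) hk'

/-- The ordered first coordinates of a Poisson process of unit intensity on the strip grow at least
linearly. -/
lemma IsPoissonPointProcess.ae_eventually_ge {Ω : Type*} [MeasurableSpace Ω] {P : Measure Ω}
    {B X : ℕ → Ω → ℝ} (hS : IsPoissonPointProcess P (fun n ω => (B n ω, X n ω))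
      ((volume : Measure (ℝ × ℝ)).restrict (Ioi (0 : ℝ) ×ˢ Icc (0 : ℝ) 1)))
    (hBmono : ∀ᵐ ω ∂P, Monotone fun n => B n ω) :
    ∀ᵐ ω ∂P, ∀ᶠ n : ℕ in Filter.atTop, (n : ℝ) / 4 ≤ B n ω := by
  have hms (n : ℕ) : MeasurableSet (Iic (n / 4 : ℝ) ×ˢ (univ : Set ℝ)) :=
    measurableSet_Iic.prod .univ
  have hvol (n : ℕ) : (volume : Measure (ℝ × ℝ)).restrict (Ioi (0 : ℝ) ×ˢ Icc (0 : ℝ) 1)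
      (Iic (n / 4 : ℝ) ×ˢ (univ : Set ℝ)) = ENNReal.ofReal (n / 4) := by
    rw [Measure.restrict_apply (hms n), prod_inter_prod, Iic_inter_Ioi, univ_inter,
      Measure.volume_eq_prod, Measure.prod_prod]
    simp
  -- Ratio of the Chernoff bounds for at least `n` points when the mean is `n/4`, with `z = 2`.
  have hlt : Real.exp (1 / 4) / 2 < 1 := by
    rw [div_lt_one (by norm_num), ← Real.lt_log_iff_exp_lt (by norm_num)]
    linarith [Real.log_two_gt_d9]
  have hbc := ae_eventually_notMem (μ := P)
    (s := fun n : ℕ => {ω | countingMeasure (fun i => (B i ω, X i ω))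
      (Iic (n / 4 : ℝ) ×ˢ (univ : Set ℝ)) ∈ Ici (n : ℝ≥0∞)}) ?_
  · filter_upwards [hbc, hBmono] with ω hω hmono
    filter_upwards [hω] with n hn
    by_contra! hlt
    exact hn (le_countingMeasure_of_forall_mem _ (hms n) n fun i hi =>
      ⟨(hmono hi.le).trans hlt.le, mem_univ _⟩)
  · refine ne_top_of_le_ne_top ?_ (ENNReal.tsum_le_tsum fun n => hS.chernoff (hms n)
      (by rw [hvol]; exact ENNReal.ofReal_ne_top) measurableSet_Ici (c := (1 / 2) ^ n) (z := 2) (by positivity)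
        (by norm_num) ?_)
    · have : ∀ n : ℕ, (1 / 2 : ℝ) ^ n * Real.exp (((volume : Measure (ℝ × ℝ)).restrict
          (Ioi (0 : ℝ) ×ˢ Icc (0 : ℝ) 1) (Iic (n / 4 : ℝ) ×ˢ (univ : Set ℝ))).toReal * (2 - 1)) =
          (Real.exp (1 / 4) / 2) ^ n := by
        intro n
        rw [hvol, ENNReal.toReal_ofReal (by positivity), div_pow, div_pow, ← Real.exp_nat_mul]
        ring_nf
      simp_rw [this]
      exact (summable_geometric_of_lt_one (by positivity) hlt).tsum_ofReal_ne_top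
    · intro k hk
      have hk' : n ≤ k := by simpa using hk
      rw [one_div, inv_pow, mul_comm, ← div_eq_mul_inv, one_le_div (by positivity)]
      exact pow_le_pow_right₀ (by norm_num) hk'


/-! ### Moments of the weighted dyadic counts. -/

/-- Points of the half-strip of height less than `2 ^ (j + 1)` whose abscissa is at distance at most
`t ^ j` from `x`. -/
def dyadicBox (t : ℝ) (j : ℕ) (x : ℝ) : Set (ℝ × ℝ) :=
  Iio ((2 : ℝ) ^ (j + 1)) ×ˢ Icc (x - t ^ j) (x + t ^ j)

lemma measurableSet_dyadicBox (t : ℝ) (j : ℕ) (x : ℝ) : MeasurableSet (dyadicBox t j x) :=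
  measurableSet_Iio.prod measurableSet_Icc

lemma volume_dyadicBox_le {t : ℝ} (ht : 0 ≤ t) (j : ℕ) (x : ℝ) :
    (volume : Measure (ℝ × ℝ)).restrict (Ioi (0 : ℝ) ×ˢ Icc (0 : ℝ) 1) (dyadicBox t j x) ≤
      4 * ENNReal.ofReal (2 * t) ^ j := by
  rw [Measure.restrict_apply (measurableSet_dyadicBox t j x), dyadicBox, prod_inter_prod]
  refine (measure_mono (prod_mono_right inter_subset_left)).trans (le_of_eq ?_)
  rw [Measure.volume_eq_prod, Measure.prod_prod, Iio_inter_Ioi, Real.volume_Ioo, Real.volume_Icc, sub_zero,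
    ← ENNReal.ofReal_mul (by positivity), ← ENNReal.ofReal_pow (by positivity),
    show (4 : ℝ≥0∞) = ENNReal.ofReal 4 by simp, ← ENNReal.ofReal_mul (by norm_num)]
  congr 1
  ring

/-- A crude substitute for Hölder: each `v j` is at most the `ℓ^p` norm of `v`. It suffices for
geometric weights `u`. -/
lemma tsum_mul_rpow_le (u v : ℕ → ℝ≥0∞) {p : ℝ} (hp : 0 < p) :
    (∑' j, u j * v j) ^ p ≤ (∑' j, u j) ^ p * ∑' j, v j ^ p := by
  have h (j : ℕ) : v j ≤ (∑' j, v j ^ p) ^ p⁻¹ := by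
    rw [ENNReal.le_rpow_inv_iff hp]
    exact ENNReal.le_tsum j
  calc (∑' j, u j * v j) ^ p ≤ (∑' j, u j * (∑' j, v j ^ p) ^ p⁻¹) ^ p := by
        gcongr with j
        exact h j
    _ = (∑' j, u j) ^ p * ∑' j, v j ^ p := by
        rw [ENNReal.tsum_mul_right, ENNReal.mul_rpow_of_nonneg _ _ hp.le,
          ENNReal.rpow_inv_rpow hp.ne']

section Moment

variable {Ω : Type*} [MeasurableSpace Ω] {P : Measure Ω} {B X : ℕ → Ω → ℝ}

lemma measurable_count_dyadicBox (hS : ∀ n, Measurable fun ω => (B n ω, X n ω)) (t : ℝ) (j : ℕ) :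
    Measurable fun z : ℝ × Ω =>
      countingMeasure (fun n => (B n z.2, X n z.2)) (dyadicBox t j z.1) := by
  simp_rw [countingMeasure_apply _ (measurableSet_dyadicBox t j _)]
  refine Measurable.tsum fun n => ?_
  have hB : Measurable fun z : ℝ × Ω => B n z.2 := (hS n).fst.comp measurable_snd
  have hX : Measurable fun z : ℝ × Ω => X n z.2 := (hS n).snd.comp measurable_snd
  have hms : MeasurableSet {z : ℝ × Ω | (B n z.2, X n z.2) ∈ dyadicBox t j z.1} :=
    (measurableSet_lt hB measurable_const).inter
      ((measurableSet_le (measurable_fst.sub_const _) hX).inter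
        (measurableSet_le hX (measurable_fst.add_const _)))
  exact measurable_one.indicator hms

lemma IsPoissonPointProcess.ae_lintegral_tsum_rpow_lt_top [IsProbabilityMeasure P]
    (hS : IsPoissonPointProcess P (fun n ω => (B n ω, X n ω))
      ((volume : Measure (ℝ × ℝ)).restrict (Ioi (0 : ℝ) ×ˢ Icc (0 : ℝ) 1)))
    {t b p : ℝ} (ht : 0 ≤ t) (ht1 : 2 * t ≤ 1) (hb : 0 ≤ b) (hp : 0 < p)
    (hbt : b ^ p * (2 * t) < 1) :
    ∀ᵐ ω ∂P, ∫⁻ x in Icc (0 : ℝ) 1, (∑' j, ENNReal.ofReal b ^ j *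
      countingMeasure (fun n => (B n ω, X n ω)) (dyadicBox t j x)) ^ p < ∞ := by
  -- The strict inequality leaves room to split `b = s * β`, with `s < 1` giving a summable weight
  -- and `β ^ p * 2t < 1` still.
  obtain ⟨v, hv, hv1⟩ := exists_between hbt
  have hv0 : 0 < v := lt_of_le_of_lt (by positivity) hv
  set s := v ^ p⁻¹ with hs
  have hs0 : 0 < s := Real.rpow_pos_of_pos hv0 _
  have hs1 : s < 1 := Real.rpow_lt_one hv0.le hv1 (by positivity)
  have hsp : s ^ p = v := Real.rpow_inv_rpow hv0.le hp.ne'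
  set β := ENNReal.ofReal (b / s) with hβ
  have hbβ : ENNReal.ofReal b = ENNReal.ofReal s * β := by
    rw [hβ, ← ENNReal.ofReal_mul hs0.le, mul_div_cancel₀ _ hs0.ne']
  have hr : β ^ p * ENNReal.ofReal (2 * t) < 1 := by
    rw [hβ, ENNReal.ofReal_rpow_of_nonneg (by positivity) hp.le,
      ← ENNReal.ofReal_mul (by positivity), ENNReal.ofReal_lt_one, Real.div_rpow hb hs0.le, hsp,
      div_mul_eq_mul_div, div_lt_one hv0]
    exact hv
  set N : ℕ → ℝ × Ω → ℝ≥0∞ := fun j z =>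
    countingMeasure (fun n => (B n z.2, X n z.2)) (dyadicBox t j z.1) with hN
  have hNm (j : ℕ) : Measurable (N j) := measurable_count_dyadicBox hS.measurable t j
  -- Since `2t ≤ 1`, every box has measure at most `4`, so one `D` serves all `j` and `x`.
  obtain ⟨D, hD, hDle⟩ := hS.exists_lintegral_count_rpow_le hp 4
  have hmom (j : ℕ) (x : ℝ) : ∫⁻ ω, N j (x, ω) ^ p ∂P ≤
      D * (4 * ENNReal.ofReal (2 * t) ^ j) := by
    have hvol := volume_dyadicBox_le ht j x
    refine (hDle _ (measurableSet_dyadicBox t j x) (hvol.trans ?_)).trans (by gcongr)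
    refine (mul_le_of_le_one_right' (pow_le_one' ?_ j)).trans (by simp)
    rwa [ENNReal.ofReal_le_one]
  have hterm (j : ℕ) : Measurable fun z => (β ^ j * N j z) ^ p :=
    ((hNm j).const_mul _).pow_const p
  have hsum : Measurable fun z => ∑' j, (β ^ j * N j z) ^ p := Measurable.tsum hterm
  have hfin : ∫⁻ ω, (∫⁻ x in Icc (0 : ℝ) 1, ∑' j, (β ^ j * N j (x, ω)) ^ p) ∂P ≠ ∞ := by
    rw [lintegral_lintegral_swap (f := fun ω x => ∑' j, (β ^ j * N j (x, ω)) ^ p)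
      (hsum.comp measurable_swap).aemeasurable]
    have hx (x : ℝ) : ∫⁻ ω, ∑' j, (β ^ j * N j (x, ω)) ^ p ∂P ≤
        D * 4 * ∑' j : ℕ, (β ^ p * ENNReal.ofReal (2 * t)) ^ j := by
      rw [lintegral_tsum (f := fun j ω => (β ^ j * N j (x, ω)) ^ p)
          fun j => ((hterm j).comp measurable_prodMk_left).aemeasurable,
        ← ENNReal.tsum_mul_left]
      refine ENNReal.tsum_le_tsum fun j => ?_
      simp_rw [ENNReal.mul_rpow_of_nonneg _ _ hp.le]
      rw [lintegral_const_mul (f := fun ω => N j (x, ω) ^ p) _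
        (((hNm j).comp measurable_prodMk_left).pow_const p)]
      refine (mul_le_mul_right (hmom j x) _).trans (le_of_eq ?_)
      rw [mul_pow, ← ENNReal.rpow_natCast β, ← ENNReal.rpow_natCast (β ^ p), ← ENNReal.rpow_mul,
        ← ENNReal.rpow_mul, mul_comm p]
      ring
    refine ne_top_of_le_ne_top ?_ (lintegral_mono hx)
    rw [lintegral_const, ENNReal.tsum_geometric]
    refine ENNReal.mul_ne_top (ENNReal.mul_ne_top (ENNReal.mul_ne_top hD (by simp)) ?_) (by simp)
    exact ENNReal.inv_ne_top.2 (tsub_pos_of_lt hr).ne'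
  have hmeas : Measurable fun ω => ∫⁻ x in Icc (0 : ℝ) 1, ∑' j, (β ^ j * N j (x, ω)) ^ p :=
    hsum.lintegral_prod_left
  filter_upwards [ae_lt_top hmeas hfin] with ω hω
  have hS1 : (∑' j : ℕ, ENNReal.ofReal s ^ j) ^ p ≠ ∞ := by
    rw [ENNReal.tsum_geometric]
    refine ENNReal.rpow_ne_top_of_nonneg hp.le (ENNReal.inv_ne_top.2 (tsub_pos_of_lt ?_).ne')
    rwa [ENNReal.ofReal_lt_one]
  calc ∫⁻ x in Icc (0 : ℝ) 1, (∑' j, ENNReal.ofReal b ^ j * N j (x, ω)) ^ p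
      ≤ ∫⁻ x in Icc (0 : ℝ) 1,
        (∑' j : ℕ, ENNReal.ofReal s ^ j) ^ p * ∑' j, (β ^ j * N j (x, ω)) ^ p := by
        refine lintegral_mono fun x => ?_
        simp_rw [hbβ, mul_pow, mul_assoc]
        exact tsum_mul_rpow_le _ _ hp
    _ = (∑' j : ℕ, ENNReal.ofReal s ^ j) ^ p *
        ∫⁻ x in Icc (0 : ℝ) 1, ∑' j, (β ^ j * N j (x, ω)) ^ p :=
        lintegral_const_mul' _ _ hS1
    _ < ∞ := ENNReal.mul_lt_top hS1.lt_top hω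

end Moment

/-! ### Pathwise estimates for fixed sequences. -/

section Deterministic

variable {ψ : ℝ → ℝ} {α η : ℝ} {C B X : ℕ → ℝ}

lemma exists_forall_le_mul_of_eventually_le {u v : ℕ → ℝ} (hv : ∀ n, 0 < v n) {k : ℝ}
    (h : ∀ᶠ n in Filter.atTop, u n ≤ k * v n) : ∃ K : ℝ, 0 < K ∧ ∀ n, u n ≤ K * v n := by
  have hb : Filter.IsBoundedUnder (· ≤ ·) Filter.atTop fun n => u n / v n :=
    ⟨k, Filter.eventually_map.2 (h.mono fun n hn => (div_le_iff₀ (hv n)).2 hn)⟩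
  obtain ⟨K, hK⟩ := hb.bddAbove_range
  refine ⟨max K 1, by positivity, fun n => (div_le_iff₀ (hv n)).1 ?_⟩
  exact (hK (mem_range_self n)).trans (le_max_left _ _)

lemma le_one_of_pulse_ne_zero (hψ : Function.support ψ ⊆ Icc (-1) 1) (hB : ∀ n, 0 < B n)
    {n : ℕ} {x : ℝ} (h : pulse ψ α η C B X n x ≠ 0) : B n ^ (1 / η) * |x - X n| ≤ 1 := by
  have h1 : B n ^ (1 / η) * (x - X n) ∈ Icc (-1 : ℝ) 1 := hψ (right_ne_zero_of_mul h)
  have h2 := abs_le.2 h1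
  rwa [abs_mul, abs_of_pos (Real.rpow_pos_of_pos (hB n) _)] at h2

/-- The lengths of the supports of the pulses are summable, so that almost every point lies in
finitely many of them. -/
lemma ae_summable_pulse (hψ : Function.support ψ ⊆ Icc (-1) 1) (hη : η ∈ Ioo (0 : ℝ) 1)
    (hB : ∀ n, 0 < B n) {K : ℝ} (hK : 0 < K) (hBK : ∀ n : ℕ, ((n + 1 : ℕ) : ℝ) ≤ K * B n) :
    ∀ᵐ x : ℝ, Summable fun n => pulse ψ α η C B X n x := by
  have hη1 : 1 < 1 / η := (one_lt_div hη.1).2 hη.2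
  have hsub (n : ℕ) : Function.support (pulse ψ α η C B X n) ⊆
      Icc (X n - (B n ^ (1 / η))⁻¹) (X n + (B n ^ (1 / η))⁻¹) := by
    intro x hx
    have h := le_one_of_pulse_ne_zero hψ hB hx
    rw [mul_comm, ← le_div_iff₀ (Real.rpow_pos_of_pos (hB n) _), one_div, abs_le] at h
    constructor <;> linarith [h.1, h.2]
  have hvol (n : ℕ) : volume (Function.support (pulse ψ α η C B X n)) ≤
      ENNReal.ofReal (2 * K ^ (1 / η) * (((n + 1 : ℕ) : ℝ) ^ (1 / η))⁻¹) := by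
    refine (measure_mono (hsub n)).trans ?_
    rw [Real.volume_Icc]
    refine ENNReal.ofReal_le_ofReal ?_
    have hn : (0 : ℝ) < ((n + 1 : ℕ) : ℝ) := by positivity
    have h1 : ((n + 1 : ℕ) : ℝ) ^ (1 / η) ≤ K ^ (1 / η) * B n ^ (1 / η) := by
      rw [← Real.mul_rpow hK.le (hB n).le]
      exact Real.rpow_le_rpow hn.le (hBK n) (by linarith)
    have h2 : (B n ^ (1 / η))⁻¹ ≤ K ^ (1 / η) * (((n + 1 : ℕ) : ℝ) ^ (1 / η))⁻¹ := by
      rw [← div_eq_mul_inv, le_div_iff₀ (Real.rpow_pos_of_pos hn _),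
        inv_mul_le_iff₀ (Real.rpow_pos_of_pos (hB n) _)]
      linarith
    linarith
  have hsm : Summable fun n : ℕ => 2 * K ^ (1 / η) * (((n + 1 : ℕ) : ℝ) ^ (1 / η))⁻¹ :=
    ((summable_nat_add_iff 1).2 (Real.summable_nat_rpow_inv.2 hη1)).mul_left _
  have hbc := ae_eventually_notMem (μ := (volume : Measure ℝ))
    (ne_top_of_le_ne_top hsm.tsum_ofReal_ne_top (ENNReal.tsum_le_tsum hvol))
  filter_upwards [hbc] with x hx
  obtain ⟨m, hm⟩ := Filter.eventually_atTop.1 hx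
  refine summable_of_ne_finset_zero (s := Finset.range m) fun n hn => ?_
  exact Function.notMem_support.1 (hm n (by simpa using hn))

/-- Each pulse that is nonzero at `x` is charged to one box containing its point, at the scale `2 ^
j` of `B n`, where the amplitude is at most a constant times `2 ^ (-α j)`. -/
lemma tsum_enorm_pulse_le (hψ : Function.support ψ ⊆ Icc (-1) 1) {M : ℝ} (hM : ∀ y, |ψ y| ≤ M)
    (hη : 0 < η) (hα : α < 0) (hC : ∀ n, 0 ≤ C n) (hB : ∀ n, 0 < B n)
    (hX : ∀ n, X n ∈ Icc (0 : ℝ) 1) {K : ℝ} (hK : 0 < K) (hCK : ∀ n, C n ≤ K * B n) {x : ℝ}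
    (hx : x ∈ Icc (0 : ℝ) 1) :
    ∑' n, ‖pulse ψ α η C B X n x‖ₑ ≤ ENNReal.ofReal ((2 * K) ^ (-α) * M) *
      ∑' j, ENNReal.ofReal (2 ^ (-α)) ^ j *
        countingMeasure (fun n => (B n, X n)) (dyadicBox (2 ^ (-(1 / η))) j x) := by
  simp_rw [countingMeasure_apply _ (measurableSet_dyadicBox _ _ _), ← ENNReal.tsum_mul_left]
  rw [ENNReal.tsum_comm]
  refine ENNReal.tsum_le_tsum fun n => ?_
  by_cases h0 : pulse ψ α η C B X n x = 0
  · simp [h0]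
  have hM0 : 0 ≤ M := (abs_nonneg _).trans (hM 0)
  have h1 := le_one_of_pulse_ne_zero hψ hB h0
  have hη0 : 0 < 1 / η := by positivity
  obtain ⟨j, hj, hd⟩ : ∃ j : ℕ, B n < 2 ^ (j + 1) ∧ |x - X n| ≤ ((2 : ℝ) ^ (-(1 / η))) ^ j := by
    rcases lt_or_ge (B n) 1 with hlt | hge
    -- Heights below `1` go to scale `0`: its width `t ^ 0 = 1` suffices because `x` and `X n` lie
    -- in `[0,1]`.
    · refine ⟨0, by norm_num; linarith, ?_⟩
      rw [pow_zero, abs_le]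
      constructor <;> linarith [hx.1, hx.2, (hX n).1, (hX n).2]
    · obtain ⟨j, hj1, hj2⟩ := exists_nat_pow_near hge one_lt_two
      refine ⟨j, hj2, ?_⟩
      have h2 : ((2 : ℝ) ^ (-(1 / η))) ^ j = (((2 : ℝ) ^ j) ^ (1 / η))⁻¹ := by
        rw [Real.rpow_neg (by norm_num), inv_pow, ← Real.rpow_natCast, ← Real.rpow_natCast,
          ← Real.rpow_mul (by norm_num), ← Real.rpow_mul (by norm_num), mul_comm]
      rw [h2, ← one_div, le_div_iff₀ (by positivity), mul_comm]
      have h3 : ((2 : ℝ) ^ j) ^ (1 / η) ≤ B n ^ (1 / η) :=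
        Real.rpow_le_rpow (by positivity) hj1 hη0.le
      exact (mul_le_mul_of_nonneg_right h3 (abs_nonneg _)).trans h1
  refine le_trans ?_ (ENNReal.le_tsum j)
  have hmem : (B n, X n) ∈ dyadicBox (2 ^ (-(1 / η))) j x := by
    have := abs_le.1 hd
    exact ⟨hj, by linarith [this.2], by linarith [this.1]⟩
  rw [indicator_of_mem hmem, Pi.one_apply, mul_one, ← ENNReal.ofReal_pow (by positivity),
    ← ENNReal.ofReal_mul (by positivity), ← ofReal_norm]
  refine ENNReal.ofReal_le_ofReal ?_
  rw [pulse, norm_mul, Real.norm_eq_abs, Real.norm_eq_abs,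
    abs_of_nonneg (Real.rpow_nonneg (hC n) _)]
  have h4 : C n ^ (-α) ≤ (2 * K) ^ (-α) * (2 ^ (-α)) ^ j := by
    have h5 : ((2 : ℝ) ^ (-α)) ^ j = ((2 : ℝ) ^ j) ^ (-α) := by
      rw [← Real.rpow_natCast, ← Real.rpow_natCast, ← Real.rpow_mul (by norm_num),
        ← Real.rpow_mul (by norm_num), mul_comm]
    rw [h5, ← Real.mul_rpow (by positivity) (by positivity)]
    refine Real.rpow_le_rpow (hC n) ((hCK n).trans ?_) (by linarith)
    calc K * B n ≤ K * 2 ^ (j + 1) := by gcongr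
      _ = 2 * K * 2 ^ j := by ring
  calc C n ^ (-α) * |ψ (B n ^ (1 / η) * (x - X n))|
      ≤ ((2 * K) ^ (-α) * (2 ^ (-α)) ^ j) * M := by
        gcongr
        exact hM _
    _ = _ := by ring

lemma aestronglyMeasurable_pulseSum (hψ : Measurable ψ)
    (h : ∀ᵐ x : ℝ, Summable fun n => pulse ψ α η C B X n x) :
    AEStronglyMeasurable (pulseSum ψ α η C B X) volume := by
  refine aestronglyMeasurable_of_tendsto_ae Filter.atTop
    (f := fun m x => ∑ n ∈ Finset.range m, pulse ψ α η C B X n x) (fun m => ?_)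
    (h.mono fun x hx => hx.hasSum.tendsto_sum_nat)
  refine (Finset.measurable_sum _ fun n _ => ?_).aestronglyMeasurable
  exact (hψ.comp ((measurable_id.sub_const _).const_mul _)).const_mul _

lemma memLp_pulseSum_of_lintegral_lt_top (hψm : Measurable ψ)
    (hψ : Function.support ψ ⊆ Icc (-1) 1) {M : ℝ}
    (hM : ∀ y, |ψ y| ≤ M) (hη : 0 < η) (hα : α < 0) (hC : ∀ n, 0 ≤ C n) (hB : ∀ n, 0 < B n)
    (hX : ∀ n, X n ∈ Icc (0 : ℝ) 1) {K : ℝ} (hK : 0 < K) (hCK : ∀ n, C n ≤ K * B n)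
    (hs : ∀ᵐ x : ℝ, Summable fun n => pulse ψ α η C B X n x) {p : ℝ} (hp : 0 < p)
    (hfin : ∫⁻ x in Icc (0 : ℝ) 1, (∑' j, ENNReal.ofReal (2 ^ (-α)) ^ j *
      countingMeasure (fun n => (B n, X n)) (dyadicBox (2 ^ (-(1 / η))) j x)) ^ p < ∞) :
    MemLp (pulseSum ψ α η C B X) (ENNReal.ofReal p) (volume.restrict (Icc (0 : ℝ) 1)) := by
  refine ⟨(aestronglyMeasurable_pulseSum hψm hs).restrict, ?_⟩
  rw [eLpNorm_lt_top_iff_lintegral_rpow_enorm_lt_top (by simpa using hp) ENNReal.ofReal_ne_top,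
    ENNReal.toReal_ofReal hp.le]
  set c := ENNReal.ofReal ((2 * K) ^ (-α) * M)
  have hc : c ^ p ≠ ∞ := ENNReal.rpow_ne_top_of_nonneg hp.le ENNReal.ofReal_ne_top
  refine lt_of_le_of_lt (setLIntegral_mono' measurableSet_Icc fun x hx => ?_)
    ((lintegral_const_mul' (c ^ p) _ hc).trans_lt (ENNReal.mul_lt_top hc.lt_top hfin))
  rw [← ENNReal.mul_rpow_of_nonneg _ _ hp.le]
  exact ENNReal.rpow_le_rpow (enorm_tsum_le_tsum_enorm.trans
    (tsum_enorm_pulse_le hψ hM hη hα hC hB hX hK hCK hx)) hp.le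

end Deterministic

lemma exists_forall_abs_le_of_support_subset {ψ : ℝ → ℝ} (hψ : Continuous ψ)
    (hψsupp : Function.support ψ ⊆ Icc (-1) 1) : ∃ M, ∀ y, |ψ y| ≤ M :=
  hψ.bounded_above_of_compact_support (HasCompactSupport.intro isCompact_Icc fun _ hy =>
    Function.notMem_support.1 fun h => hy (hψsupp h))

lemma two_rpow_mul_lt_one {α η p : ℝ} (hη : 0 < η) (hα : α < 0)
    (hp : p < -1 / (α * η) + 1 / α) :
    ((2 : ℝ) ^ (-α)) ^ p * (2 * 2 ^ (-(1 / η))) < 1 := by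
  have h : -α * p + (1 + -(1 / η)) < 0 := by
    have h1 := mul_lt_mul_of_pos_left hp (neg_pos.2 hα)
    have h2 : -α * (-1 / (α * η) + 1 / α) = 1 / η - 1 := by
      have := hα.ne
      field_simp
      ring
    linarith
  rw [← Real.rpow_mul (by norm_num)]
  nth_rewrite 2 [← Real.rpow_one 2]
  rw [← Real.rpow_add (by norm_num), ← Real.rpow_add (by norm_num)]
  exact Real.rpow_lt_one_of_one_lt_of_neg (by norm_num) h

end RandomPulses

/-! ### Assembly of the almost sure statement. -/

theorem proposition4p3 {Ω : Type*} [MeasurableSpace Ω] (P : Measure Ω) [IsProbabilityMeasure P]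
    (C B X : ℕ → Ω → ℝ)
    -- `(Cₙ)`: the points of a Poisson process on `ℝ₊` with Lebesgue intensity, increasing in `n`
    (hC : RandomPulses.IsPoissonPointProcess P C (volume.restrict (Ici (0 : ℝ))))
    (hCmono : ∀ᵐ ω ∂P, Monotone fun n => C n ω)
    -- `(Bₙ, Xₙ)`: a Poisson process on `ℝ₊* × [0,1]` with Lebesgue intensity, `(Bₙ)` increasing
    (hS : RandomPulses.IsPoissonPointProcess P (fun n ω => (B n ω, X n ω))
      ((volume : Measure (ℝ × ℝ)).restrict (Ioi (0 : ℝ) ×ˢ Icc (0 : ℝ) 1)))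
    (hBmono : ∀ᵐ ω ∂P, Monotone fun n => B n ω)
    -- the two point processes are independent
    (hindep : IndepFun (fun ω n => C n ω) (fun ω n => (B n ω, X n ω)) P)
    (ψ : ℝ → ℝ) (hψ : ∃ L : ℝ≥0, LipschitzWith L ψ)
    (hψsupp : Function.support ψ ⊆ Icc (-1) 1)
    (α η : ℝ) (hη : η ∈ Ioo (0 : ℝ) 1) (hα : α < 0) (hαη : η - 1 < α * η) :
    ∀ᵐ ω ∂P,
      (∀ᵐ x : ℝ, Summable fun n =>
        RandomPulses.pulse ψ α η (fun n => C n ω) (fun n => B n ω) (fun n => X n ω) n x) ∧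
      ∀ p : ℝ, p ∈ Ioo 1 (-1 / (α * η) + 1 / α) →
        RandomPulses.MemLpLocOn
          (RandomPulses.pulseSum ψ α η (fun n => C n ω) (fun n => B n ω) (fun n => X n ω))
          (ENNReal.ofReal p) (Icc 0 1) := by
  obtain ⟨L, hL⟩ := hψ
  obtain ⟨M, hM⟩ := RandomPulses.exists_forall_abs_le_of_support_subset hL.continuous hψsupp
  have hη1 : 1 < 1 / η := (one_lt_div hη.1).2 hη.2
  have ht1 : 2 * (2 : ℝ) ^ (-(1 / η)) ≤ 1 := by
    nth_rewrite 1 [← Real.rpow_one 2]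
    rw [← Real.rpow_add (by norm_num)]
    exact Real.rpow_le_one_of_one_le_of_nonpos (by norm_num) (by linarith)
  -- Rational exponents keep the exceptional set null; a real `p` is later reached from a rational
  -- `q > p`, as the measure on `[0,1]` is finite.
  have hmom : ∀ᵐ ω ∂P, ∀ q : ℚ, (q : ℝ) ∈ Ioo 1 (-1 / (α * η) + 1 / α) →
      ∫⁻ x in Icc (0 : ℝ) 1, (∑' j, ENNReal.ofReal (2 ^ (-α)) ^ j * RandomPulses.countingMeasure
        (fun n => (B n ω, X n ω)) (RandomPulses.dyadicBox (2 ^ (-(1 / η))) j x)) ^ (q : ℝ) < ∞ := by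
    refine ae_all_iff.2 fun q => ?_
    by_cases hq : (q : ℝ) ∈ Ioo 1 (-1 / (α * η) + 1 / α)
    · filter_upwards [hS.ae_lintegral_tsum_rpow_lt_top (by positivity) ht1 (by positivity)
        (zero_lt_one.trans hq.1) (RandomPulses.two_rpow_mul_lt_one hη.1 hα hq.2)] with ω hω _ using hω
    · exact ae_of_all _ fun ω h => absurd h hq
  have hCnn := hC.ae_notMem measurableSet_Iio (A := Iio 0) (by
    rw [Measure.restrict_apply measurableSet_Iio, Iio_inter_Ici, Ico_self, measure_empty])
  have hstrip : MeasurableSet (Ioi (0 : ℝ) ×ˢ Icc (0 : ℝ) 1) :=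
    measurableSet_Ioi.prod measurableSet_Icc
  have hSmem := hS.ae_notMem hstrip.compl (by
    rw [Measure.restrict_apply hstrip.compl, compl_inter_self, measure_empty])
  filter_upwards [hmom, hCnn, hSmem, hC.ae_eventually_le hCmono, hS.ae_eventually_ge hBmono]
    with ω hq hC0 hS0 hCle hBge
  have hS1 (n : ℕ) : (B n ω, X n ω) ∈ Ioi (0 : ℝ) ×ˢ Icc (0 : ℝ) 1 := not_not.1 (hS0 n)
  have hB0 (n : ℕ) : 0 < B n ω := (hS1 n).1
  have hX0 (n : ℕ) : X n ω ∈ Icc (0 : ℝ) 1 := (hS1 n).2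
  have hC0' (n : ℕ) : 0 ≤ C n ω := not_lt.1 (hC0 n)
  obtain ⟨K, hK, hCK⟩ := RandomPulses.exists_forall_le_mul_of_eventually_le (k := 16)
    (u := fun n => C n ω) hB0
    ((hCle.and hBge).mono fun n hn => by linarith [hn.1, hn.2])
  obtain ⟨K', hK', hBK⟩ := RandomPulses.exists_forall_le_mul_of_eventually_le (k := 8)
    (u := fun n => ((n + 1 : ℕ) : ℝ)) hB0
    ((hBge.and (Filter.eventually_ge_atTop 1)).mono fun n hn => by
      have : (1 : ℝ) ≤ n := by exact_mod_cast hn.2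
      push_cast
      linarith [hn.1])
  have hsum : ∀ᵐ x : ℝ, Summable fun n =>
      RandomPulses.pulse ψ α η (fun n => C n ω) (fun n => B n ω) (fun n => X n ω) n x :=
    RandomPulses.ae_summable_pulse hψsupp hη hB0 hK' hBK
  refine ⟨hsum, fun p hp K₀ _ hK₀ => ?_⟩
  obtain ⟨q, hpq, hq'⟩ := exists_rat_btwn hp.2
  have hq1 : (1 : ℝ) < q := hp.1.trans hpq
  have hmem := RandomPulses.memLp_pulseSum_of_lintegral_lt_top hL.continuous.measurable hψsupp hM hη.1 hα hC0'
    hB0 hX0 hK hCK hsum (zero_lt_one.trans hq1) (hq q ⟨hq1, hq'⟩)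
  exact (hmem.mono_exponent (ENNReal.ofReal_le_ofReal hpq.le)).mono_measure
    (Measure.restrict_mono hK₀ le_rfl)
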